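/- Let $0\le k\le r$ be integers and let $M$ be a compact Hausdorff smooth $n$-manifold without boundary. A local $C^k$ parametrization of $M$ is a $C^k$ diffeomorphism $u$ from an open neighbourhood of $0\in\mathbb R^n$ onto an open subset of $M$. Let $P^k(M)$ be the $k$-th order frame bundle, the space of $k$-jets $j^k_0u$ of such $u$, with its usual topology (given by the Taylor coefficients in charts). Let $D^k$ be the topological group of $k$-jets at $0$ of local $C^k$ diffeomorphisms $a$ of $\mathbb R^n$ fixing $0$, acting on $P^k(M)$ by $j^k_0a\cdot j^k_0u=j^k_0(u\circ a^{-1})$. Every $f\in\mathrm{Diff}^r(M)$ acts on $P^k(M)$ by $j^k_0u\mapsto j^k_0(f\circ u)$. A geometric structure of order $k$ on $M$ is a continuous $D^k$-equivariant map $\omega:P^k(M)\to V$, where $V$ is a Hausdorff topological manifold with a continuous action of $D^k$. Its automorphism group $\mathrm{Aut}^r(\omega)$ consists of all $f\in\mathrm{Diff}^r(M)$ whose action on $P^k(M)$ satisfies $\omega\circ f=\omega$. The structure $\omega$ is rigid of order $r$ if $\mathrm{Aut}^r(\omega)$, with the $C^r$ topology (the compact-open topology of the action on $P^r(M)$), acts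 freely and properly on $P^r(M)$. Let $\Gamma$ be a countable group acting on $M$ by $C^r$ diffeomorphisms, and identify $\Gamma$ with its image in $\mathrm{Diff}^r(M)$. Let $\mathrm{Inn}^r(M,\Gamma)$ be the group of all $f\in\mathrm{Diff}^r(M)$ with $f(x)\in\Gamma x$ for every $x\in M$, and let $\mathrm{Aut}^r(M,\Gamma)$ be the group of all $f\in\mathrm{Diff}^r(M)$ that preserve the orbit equivalence relation: $f(x)$ and $f(y)$ lie in the same $\Gamma$-orbit if and only if $x$ and $y$ do. **Theorem.** Suppose that $\Gamma$ preserves a geometric structure $\omega$ of order $k\le r$ on $M$ (that is, $\Gamma\subset\mathrm{Aut}^r(\omega)$) which is rigid of order $r$. Then $$\Gamma=\mathrm{Inn}^r(M,\Gamma).$$ Consequently, every $f\in\mathrm{Aut}^r(M,\Gamma)$ is equivariant, i.e. there is an automorphism $\alpha$ of $\Gamma$ with $f(\gamma x)=\alpha(\gamma)f(x)$ for all $\gamma\in\Gamma$ and $x\in M$, and $\mathrm{Aut}^r(M,\Gamma)$ is the normalizer of $\Gamma$ in $\mathrm{Diff}^r(M)$. -/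

import Mathlib

open Set Topology Manifold ContDiff

noncomputable section

namespace RigidAction

/-- The model space `ℝⁿ`. -/
abbrev Euc (n : ℕ) : Type := EuclideanSpace ℝ (Fin n)

section Jets

variable {n k r : ℕ}
variable {M : Type*} [TopologicalSpace M] [ChartedSpace (Euc n) M]

/-- Two maps `u, v : ℝⁿ → M` have the same `k`-jet at the origin: they have the same value there and,
in the chart of `M` at that value, the same derivatives up to order `k` at the origin. -/
def SameJet (k : ℕ) (u v : Euc n → M) : Prop :=
  u 0 = v 0 ∧ ∀ i : ℕ, i ≤ k →
    iteratedFDeriv ℝ i (extChartAt (𝓡 n) (u 0) ∘ u) 0 =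
      iteratedFDeriv ℝ i (extChartAt (𝓡 n) (u 0) ∘ v) 0

/-- A `C^k` diffeomorphism from an open neighbourhood of the origin of `ℝⁿ` onto an open subset
of `M`. -/
structure LocalParam (n k : ℕ) (M : Type*) [TopologicalSpace M] [ChartedSpace (Euc n) M]
    extends OpenPartialHomeomorph (Euc n) M where
  zero_mem : (0 : Euc n) ∈ source
  contMDiffOn_to : ContMDiffOn (𝓡 n) (𝓡 n) k toFun source
  contMDiffOn_inv : ContMDiffOn (𝓡 n) (𝓡 n) k invFun target

/-- A `C^k` diffeomorphism between two open neighbourhoods of the origin of `ℝⁿ`, fixing the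
origin. -/
structure LocalDiff (n k : ℕ) extends LocalParam n k (Euc n) where
  map_zero : toFun 0 = 0

namespace SameJet

theorem refl (u : Euc n → M) : SameJet k u u := ⟨rfl, fun _ _ => rfl⟩

theorem symm {u v : Euc n → M} (h : SameJet k u v) : SameJet k v u :=
  ⟨h.1.symm, fun i hi => by rw [← h.1]; exact (h.2 i hi).symm⟩

theorem trans {u v w : Euc n → M} (h : SameJet k u v) (h' : SameJet k v w) : SameJet k u w :=
  ⟨h.1.trans h'.1, fun i hi => (h.2 i hi).trans (by rw [h.1]; exact h'.2 i hi)⟩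

theorem of_eventuallyEq {u v : Euc n → M} (h : u =ᶠ[𝓝 0] v) : SameJet k u v :=
  ⟨h.eq_of_nhds, fun i _ =>
    Filter.EventuallyEq.eq_of_nhds
      (Filter.EventuallyEq.iteratedFDeriv ℝ (h.fun_comp (extChartAt (𝓡 n) (u 0))) i)⟩

end SameJet

/-- Chain rule: the `k`-jet of a composition depends only on the `k`-jets of the two maps. -/
theorem iteratedFDeriv_comp_congr {g₁ g₂ f₁ f₂ : Euc n → Euc n} {x : Euc n}
    (hg₁ : ContDiffAt ℝ k g₁ (f₁ x)) (hg₂ : ContDiffAt ℝ k g₂ (f₁ x))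
    (hf₁ : ContDiffAt ℝ k f₁ x) (hf₂ : ContDiffAt ℝ k f₂ x) (h0 : f₁ x = f₂ x)
    (hf : ∀ i ≤ k, iteratedFDeriv ℝ i f₁ x = iteratedFDeriv ℝ i f₂ x)
    (hg : ∀ i ≤ k, iteratedFDeriv ℝ i g₁ (f₁ x) = iteratedFDeriv ℝ i g₂ (f₁ x))
    (i : ℕ) (hi : i ≤ k) :
    iteratedFDeriv ℝ i (g₁ ∘ f₁) x = iteratedFDeriv ℝ i (g₂ ∘ f₂) x := by
  have hi' : (i : WithTop ℕ∞) ≤ k := by exact_mod_cast hi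
  rw [iteratedFDeriv_comp hg₁ hf₁ hi', iteratedFDeriv_comp (h0 ▸ hg₂) hf₂ hi', ← h0]
  simp only [FormalMultilinearSeries.taylorComp]
  refine Finset.sum_congr rfl fun c _ => ?_
  change c.compAlongOrderedFinpartition (iteratedFDeriv ℝ c.length g₁ (f₁ x))
      (fun j => iteratedFDeriv ℝ (c.partSize j) f₁ x) =
    c.compAlongOrderedFinpartition (iteratedFDeriv ℝ c.length g₂ (f₁ x))
      (fun j => iteratedFDeriv ℝ (c.partSize j) f₂ x)
  rw [hg _ (c.length_le.trans hi)]
  congr 1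
  funext j
  exact hf _ ((c.partSize_le j).trans hi)

theorem contDiffAt_chart {u : Euc n → M} (hu : ContMDiffAt (𝓡 n) (𝓡 n) k u 0) :
    ContDiffAt ℝ k (extChartAt (𝓡 n) (u 0) ∘ u) 0 := by
  have := (contMDiffAt_iff.1 hu).2
  rwa [modelWithCornersSelf_coe, range_id, contDiffWithinAt_univ] at this

theorem SameJet.comp_left {u v : Euc n → M} (h : SameJet k u v)
    (hu : ContMDiffAt (𝓡 n) (𝓡 n) k u 0) (hv : ContMDiffAt (𝓡 n) (𝓡 n) k v 0)
    {F : M → M} (hF : ContMDiffAt (𝓡 n) (𝓡 n) k F (u 0)) : SameJet k (F ∘ u) (F ∘ v) := by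
  refine ⟨congrArg F h.1, ?_⟩
  set φ := extChartAt (𝓡 n) (u 0) with hφ
  set ψ := extChartAt (𝓡 n) (F (u 0)) with hψ
  have key : ∀ w : Euc n → M, ContMDiffAt (𝓡 n) (𝓡 n) k w 0 → w 0 = u 0 →
      (ψ ∘ (F ∘ w)) =ᶠ[𝓝 0] ((ψ ∘ F ∘ φ.symm) ∘ (φ ∘ w)) := by
    intro w hw h0
    have : ∀ᶠ y in 𝓝 (0 : Euc n), w y ∈ φ.source :=
      hw.continuousAt.preimage_mem_nhds (by rw [h0]; exact extChartAt_source_mem_nhds _)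
    filter_upwards [this] with y hy
    simp [φ.left_inv hy]
  have hG : ContDiffAt ℝ k (ψ ∘ F ∘ φ.symm) ((φ ∘ u) 0) := by
    have := (contMDiffAt_iff.1 hF).2
    rwa [modelWithCornersSelf_coe, range_id, contDiffWithinAt_univ] at this
  intro i hi
  have e1 := Filter.EventuallyEq.eq_of_nhds
    (Filter.EventuallyEq.iteratedFDeriv ℝ (key u hu rfl) i)
  have e2 := Filter.EventuallyEq.eq_of_nhds
    (Filter.EventuallyEq.iteratedFDeriv ℝ (key v hv h.1.symm) i)
  change iteratedFDeriv ℝ i (ψ ∘ (F ∘ u)) 0 = iteratedFDeriv ℝ i (ψ ∘ (F ∘ v)) 0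
  rw [e1, e2]
  refine iteratedFDeriv_comp_congr hG hG (contDiffAt_chart hu) ?_ ?_ h.2 (fun _ _ => rfl) i hi
  · have := contDiffAt_chart hv
    rwa [← h.1] at this
  · exact congrArg φ h.1

theorem SameJet.comp {u v : Euc n → M} (h : SameJet k u v)
    (hu : ContMDiffAt (𝓡 n) (𝓡 n) k u 0) (hv : ContMDiffAt (𝓡 n) (𝓡 n) k v 0)
    {a b : Euc n → Euc n} (hab : SameJet k a b) (ha0 : a 0 = 0)
    (ha : ContMDiffAt (𝓡 n) (𝓡 n) k a 0) (hb : ContMDiffAt (𝓡 n) (𝓡 n) k b 0) :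
    SameJet k (u ∘ a) (v ∘ b) := by
  have hb0 : b 0 = 0 := hab.1 ▸ ha0
  refine ⟨by simp [ha0, hb0, h.1], fun i hi => ?_⟩
  have hv' := contDiffAt_chart hv
  rw [← h.1] at hv'
  have hab' : ∀ i ≤ k, iteratedFDeriv ℝ i a 0 = iteratedFDeriv ℝ i b 0 := fun i hi => hab.2 i hi
  have := iteratedFDeriv_comp_congr (g₁ := extChartAt (𝓡 n) (u 0) ∘ u)
    (g₂ := extChartAt (𝓡 n) (u 0) ∘ v) (f₁ := a) (f₂ := b) (x := 0)
    (by rw [ha0]; exact contDiffAt_chart hu) (by rw [ha0]; exact hv')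
    ha.contDiffAt hb.contDiffAt hab.1 hab' (by rw [ha0]; exact h.2) i hi
  simpa [Function.comp_assoc, ha0] using this

end Jets

section Group

variable {n : ℕ} (r : ℕ) (M : Type*) [TopologicalSpace M] [ChartedSpace (Euc n) M]

/-- `Diff^r(M)`, the `C^r` diffeomorphisms of `M`. -/
abbrev Diff (n r : ℕ) (M : Type*) [TopologicalSpace M] [ChartedSpace (Euc n) M] : Type _ :=
  Diffeomorph (𝓡 n) (𝓡 n) M M (r : WithTop ℕ∞)

/-- Diffeomorphisms form a group under composition. -/
instance : Group (Diff n r M) where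
  mul f g := Diffeomorph.trans g f
  one := Diffeomorph.refl (𝓡 n) M r
  inv f := f.symm
  mul_assoc _ _ _ := rfl
  one_mul _ := rfl
  mul_one _ := rfl
  inv_mul_cancel f := Diffeomorph.ext fun x => f.symm_apply_apply x

variable {r M}

@[simp] theorem Diff.mul_apply (f g : Diff n r M) (x : M) : (f * g) x = f (g x) := rfl
@[simp] theorem Diff.one_apply (x : M) : (1 : Diff n r M) x = x := rfl
@[simp] theorem Diff.apply_inv_apply (f : Diff n r M) (x : M) : f (f⁻¹ x) = x :=
  f.apply_symm_apply x
@[simp] theorem Diff.inv_apply_apply (f : Diff n r M) (x : M) : f⁻¹ (f x) = x :=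
  f.symm_apply_apply x

end Group

section Frames

variable {n k r : ℕ}
variable {M : Type*} [TopologicalSpace M] [ChartedSpace (Euc n) M]

theorem LocalParam.contMDiffAt (u : LocalParam n k M) :
    ContMDiffAt (𝓡 n) (𝓡 n) k u.toFun 0 :=
  u.contMDiffOn_to.contMDiffAt (u.open_source.mem_nhds u.zero_mem)

/-- The composition `u ∘ a` on its natural domain. -/
def LocalParam.comp (u : LocalParam n k M) (a : LocalDiff n k) : LocalParam n k M where
  toOpenPartialHomeomorph := a.toOpenPartialHomeomorph.trans u.toOpenPartialHomeomorph
  zero_mem := ⟨a.zero_mem, by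
    change a.toFun 0 ∈ u.source
    rw [a.map_zero]; exact u.zero_mem⟩
  contMDiffOn_to := u.contMDiffOn_to.comp' a.contMDiffOn_to
  contMDiffOn_inv := a.contMDiffOn_inv.comp' u.contMDiffOn_inv

/-- The composition of local diffeomorphisms on its natural domain. -/
def LocalDiff.comp (a b : LocalDiff n k) : LocalDiff n k where
  toLocalParam := a.toLocalParam.comp b
  map_zero := by
    change a.toFun (b.toFun 0) = 0
    rw [b.map_zero, a.map_zero]

/-- The identity of `ℝⁿ`. -/
def LocalDiff.id (n k : ℕ) : LocalDiff n k where
  toOpenPartialHomeomorph := OpenPartialHomeomorph.refl (Euc n)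
  zero_mem := mem_univ _
  contMDiffOn_to := contMDiff_id.contMDiffOn
  contMDiffOn_inv := contMDiff_id.contMDiffOn
  map_zero := rfl

/-- The inverse local diffeomorphism. -/
def LocalDiff.symm (a : LocalDiff n k) : LocalDiff n k where
  toOpenPartialHomeomorph := a.toOpenPartialHomeomorph.symm
  zero_mem := by
    have := a.map_source a.zero_mem
    rwa [show a.toOpenPartialHomeomorph 0 = 0 from a.map_zero] at this
  contMDiffOn_to := a.contMDiffOn_inv
  contMDiffOn_inv := a.contMDiffOn_to
  map_zero := by
    have := a.left_inv a.zero_mem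
    rwa [show a.toOpenPartialHomeomorph 0 = 0 from a.map_zero] at this

/-- The composition `f ∘ u` of a local parametrization with a `C^r` diffeomorphism, `k ≤ r`. -/
def LocalParam.push (hk : k ≤ r) (f : Diff n r M) (u : LocalParam n k M) : LocalParam n k M where
  toOpenPartialHomeomorph := u.toOpenPartialHomeomorph.trans f.toHomeomorph.toOpenPartialHomeomorph
  zero_mem := ⟨u.zero_mem, mem_univ _⟩
  contMDiffOn_to :=
    (f.contMDiff.of_le (by exact_mod_cast hk)).contMDiffOn.comp' u.contMDiffOn_to
  contMDiffOn_inv := u.contMDiffOn_inv.comp'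
    ((f.symm.contMDiff.of_le (by exact_mod_cast hk)).contMDiffOn (s := univ))

/-- Local parametrizations with the same `k`-jet at the origin. -/
instance LocalParam.setoid : Setoid (LocalParam n k M) where
  r u v := SameJet k u.toFun v.toFun
  iseqv := ⟨fun _ => SameJet.refl _, SameJet.symm, SameJet.trans⟩

/-- Local diffeomorphisms with the same `k`-jet at the origin. -/
instance LocalDiff.setoid : Setoid (LocalDiff n k) where
  r a b := SameJet k a.toFun b.toFun
  iseqv := ⟨fun _ => SameJet.refl _, SameJet.symm, SameJet.trans⟩

/-- The frame bundle `P^k(M)` of order `k`: the `k`-jets at the origin of the local `C^k`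
diffeomorphisms from `ℝⁿ` to `M`. -/
def Frame (n k : ℕ) (M : Type*) [TopologicalSpace M] [ChartedSpace (Euc n) M] : Type _ :=
  Quotient (LocalParam.setoid (n := n) (k := k) (M := M))

/-- The group `D^k` of `k`-jets at the origin of local diffeomorphisms of `ℝⁿ` fixing the
origin. -/
def JetGroup (n k : ℕ) : Type := Quotient (LocalDiff.setoid (n := n) (k := k))

/-- The `k`-jet `(g(0), Dg(0), …, D^k g(0))` of a map `g : ℝⁿ → ℝⁿ`. -/
def taylorCoeff (n k : ℕ) (g : Euc n → Euc n) :
    (i : Fin (k + 1)) → ContinuousMultilinearMap ℝ (fun _ : Fin i => Euc n) (Euc n) :=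
  fun i => iteratedFDeriv ℝ i g 0

/-- The topology of `P^k(M)`: a chart `φ` of `M` gives coordinates on the part of `P^k(M)` that lies
over the domain of `φ`, namely the Taylor coefficients of `φ ∘ u` for the frame represented by `u`,
and the sets given by an open condition on these coordinates generate the topology. -/
instance Frame.topology : TopologicalSpace (Frame n k M) :=
  TopologicalSpace.generateFrom
    {W | ∃ φ ∈ atlas (Euc n) M,
      ∃ O : Set ((i : Fin (k + 1)) → ContinuousMultilinearMap ℝ (fun _ : Fin i => Euc n) (Euc n)),
        IsOpen O ∧
        W = {p | ∃ u : LocalParam n k M, Quotient.mk _ u = p ∧ u.toFun 0 ∈ φ.source ∧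
          taylorCoeff n k (φ ∘ u.toFun) ∈ O}}

/-- The Taylor coefficients of an element of `D^k`. -/
def JetGroup.coeff : JetGroup n k →
    ((i : Fin (k + 1)) → ContinuousMultilinearMap ℝ (fun _ : Fin i => Euc n) (Euc n)) :=
  Quotient.lift (fun a => taylorCoeff n k a.toFun) fun a b h => by
    funext i
    exact (show SameJet k a.toFun b.toFun from h).2 i (by omega)

/-- The topology of `D^k`, given by the Taylor coefficients. -/
instance JetGroup.topology : TopologicalSpace (JetGroup n k) :=
  TopologicalSpace.induced JetGroup.coeff inferInstance

theorem LocalDiff.comp_congr {a a' b b' : LocalDiff n k} (ha : a ≈ a') (hb : b ≈ b') :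
    a.comp b ≈ a'.comp b' :=
  SameJet.comp ha a.contMDiffAt a'.contMDiffAt hb b.map_zero b.contMDiffAt b'.contMDiffAt

theorem LocalDiff.comp_symm (a : LocalDiff n k) : a.comp a.symm ≈ LocalDiff.id n k := by
  refine SameJet.of_eventuallyEq ?_
  filter_upwards [a.symm.open_source.mem_nhds a.symm.zero_mem] with x hx
  exact a.right_inv hx

theorem LocalDiff.symm_comp (a : LocalDiff n k) : a.symm.comp a ≈ LocalDiff.id n k := by
  refine SameJet.of_eventuallyEq ?_
  filter_upwards [a.open_source.mem_nhds a.zero_mem] with x hx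
  exact a.left_inv hx

theorem LocalDiff.symm_congr {a b : LocalDiff n k} (h : a ≈ b) : a.symm ≈ b.symm := by
  have h1 : a.symm.comp (b.comp b.symm) ≈ a.symm :=
    LocalDiff.comp_congr (Setoid.refl _) b.comp_symm
  have h2 : (a.symm.comp a).comp b.symm ≈ b.symm :=
    LocalDiff.comp_congr a.symm_comp (Setoid.refl _)
  have h3 : (a.symm.comp a).comp b.symm ≈ a.symm.comp (b.comp b.symm) :=
    LocalDiff.comp_congr (a := a.symm) (Setoid.refl _)
      (LocalDiff.comp_congr h (Setoid.refl b.symm))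
  exact Setoid.trans (Setoid.symm h1) (Setoid.trans (Setoid.symm h3) h2)

/-- `D^k` is a group under composition of jets. -/
instance : Group (JetGroup n k) where
  mul := Quotient.map₂ LocalDiff.comp fun _ _ ha _ _ hb => LocalDiff.comp_congr ha hb
  one := Quotient.mk _ (LocalDiff.id n k)
  inv := Quotient.map LocalDiff.symm fun _ _ h => LocalDiff.symm_congr h
  mul_assoc := by
    rintro ⟨a⟩ ⟨b⟩ ⟨c⟩
    exact Quotient.sound (SameJet.refl _)
  one_mul := by
    rintro ⟨a⟩
    exact Quotient.sound (SameJet.refl _)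
  mul_one := by
    rintro ⟨a⟩
    exact Quotient.sound (SameJet.refl _)
  inv_mul_cancel := by
    rintro ⟨a⟩
    exact Quotient.sound a.symm_comp

/-- The right action of `D^k` on frames, `j(u) · j(a) = j(u ∘ a)`. -/
def Frame.rmul : Frame n k M → JetGroup n k → Frame n k M :=
  Quotient.map₂ LocalParam.comp fun u u' hu a a' ha =>
    SameJet.comp hu u.contMDiffAt u'.contMDiffAt ha a.map_zero a.contMDiffAt a'.contMDiffAt

/-- The principal action of `D^k` on `P^k(M)`, written as a left action:
`j(a) • j(u) = j(u ∘ a⁻¹)`. -/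
instance : MulAction (JetGroup n k) (Frame n k M) where
  smul a p := p.rmul a⁻¹
  one_smul := by
    rintro ⟨u⟩
    exact Quotient.sound (SameJet.refl _)
  mul_smul := by
    rintro ⟨a⟩ ⟨b⟩ ⟨u⟩
    exact Quotient.sound (SameJet.refl _)

/-- The prolongation of a `C^r` diffeomorphism `f` of `M` to `P^k(M)`, `k ≤ r`:
`j(u) ↦ j(f ∘ u)`. -/
def prolong (hk : k ≤ r) (f : Diff n r M) : Frame n k M → Frame n k M :=
  Quotient.map (LocalParam.push hk f) fun u v h =>
    SameJet.comp_left h u.contMDiffAt v.contMDiffAt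
      (f.contMDiff.of_le (by exact_mod_cast hk)).contMDiffAt

theorem prolong_one (hk : k ≤ r) (p : Frame n k M) : prolong hk (1 : Diff n r M) p = p := by
  induction p using Quotient.inductionOn
  exact Quotient.sound (SameJet.refl _)

theorem prolong_mul (hk : k ≤ r) (f g : Diff n r M) (p : Frame n k M) :
    prolong hk (f * g) p = prolong hk f (prolong hk g p) := by
  induction p using Quotient.inductionOn
  exact Quotient.sound (SameJet.refl _)

/-- `Diff^r(M)` acts on `P^r(M)` by prolongation. -/
instance : MulAction (Diff n r M) (Frame n r M) where
  smul f p := prolong le_rfl f p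
  one_smul := prolong_one le_rfl
  mul_smul := prolong_mul le_rfl

/-- The `C^r` topology of `Diff^r(M)`: the compact-open topology of the prolongations to
`P^r(M)`. -/
instance Diff.topology : TopologicalSpace (Diff n r M) :=
  TopologicalSpace.generateFrom
    {W | ∃ K O : Set (Frame n r M), IsCompact K ∧ IsOpen O ∧
      W = {f : Diff n r M | MapsTo (fun p => f • p) K O}}

end Frames

section GeometricStructures

variable {n k r m : ℕ}
variable {M : Type*} [TopologicalSpace M] [ChartedSpace (Euc n) M]
variable {V : Type*} [MulAction (JetGroup n k) V] [TopologicalSpace V]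

/-- A geometric structure of order `k` on `M` with values in the `D^k`-space `V`: a continuous
`D^k`-equivariant map `P^k(M) → V`. -/
structure GeometricStructure (n k : ℕ) (M : Type*) [TopologicalSpace M] [ChartedSpace (Euc n) M]
    (V : Type*) [TopologicalSpace V] [MulAction (JetGroup n k) V] where
  toFun : Frame n k M → V
  continuous_toFun : Continuous toFun
  map_smul : ∀ (a : JetGroup n k) (p : Frame n k M), toFun (a • p) = a • toFun p

/-- `Aut^r(σ)`, the group of `C^r` diffeomorphisms of `M` that preserve `σ`. -/
def GeometricStructure.aut (σ : GeometricStructure n k M V) (r : ℕ) (hk : k ≤ r) :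
    Subgroup (Diff n r M) where
  carrier := {f | ∀ p, σ.toFun (prolong hk f p) = σ.toFun p}
  one_mem' := fun p => by rw [prolong_one]
  mul_mem' := fun {f g} hf hg p => by rw [prolong_mul, hf, hg]
  inv_mem' := fun {f} hf p => by
    have := hf (prolong hk f⁻¹ p)
    rw [← prolong_mul, mul_inv_cancel, prolong_one] at this
    exact this.symm

/-- `σ` is rigid of order `r`: `Aut^r(σ)`, with the `C^r` topology, acts freely and properly on
`P^r(M)`. -/
structure GeometricStructure.IsRigid (σ : GeometricStructure n k M V) (r : ℕ) (hk : k ≤ r) :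
    Prop where
  free : ∀ (g : σ.aut r hk) (p : Frame n r M), g • p = p → g = 1
  proper : ProperSMul (σ.aut r hk) (Frame n r M)

end GeometricStructures

section OrbitEquivalence

variable {n r : ℕ} {Γ : Type*} [Group Γ]
variable {M : Type*} [TopologicalSpace M] [ChartedSpace (Euc n) M]

/-- `x` and `y` lie in the same orbit of the action `ρ` of `Γ`. -/
def OrbitRel (ρ : Γ →* Diff n r M) (x y : M) : Prop := ∃ γ : Γ, ρ γ x = y

theorem OrbitRel.symm {ρ : Γ →* Diff n r M} {x y : M} (h : OrbitRel ρ x y) : OrbitRel ρ y x := by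
  obtain ⟨γ, rfl⟩ := h
  exact ⟨γ⁻¹, by simp⟩

theorem OrbitRel.trans {ρ : Γ →* Diff n r M} {x y z : M} (h : OrbitRel ρ x y)
    (h' : OrbitRel ρ y z) : OrbitRel ρ x z := by
  obtain ⟨γ, rfl⟩ := h
  obtain ⟨δ, rfl⟩ := h'
  exact ⟨δ * γ, by simp⟩

/-- `Aut^r(M, Γ)`, the group of `C^r` diffeomorphisms that preserve the orbit equivalence
relation. -/
def orbitAut (ρ : Γ →* Diff n r M) : Subgroup (Diff n r M) where
  carrier := {f | ∀ x y, OrbitRel ρ (f x) (f y) ↔ OrbitRel ρ x y}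
  one_mem' := fun _ _ => Iff.rfl
  mul_mem' := fun {f g} hf hg x y => (hf (g x) (g y)).trans (hg x y)
  inv_mem' := fun {f} hf x y => by
    have := hf (f⁻¹ x) (f⁻¹ y)
    simpa using this.symm

/-- `Inn^r(M, Γ)`, the group of `C^r` diffeomorphisms that send every `x` to a point of `Γ x`. -/
def orbitInn (ρ : Γ →* Diff n r M) : Subgroup (Diff n r M) where
  carrier := {f | ∀ x, OrbitRel ρ x (f x)}
  one_mem' := fun _ => ⟨1, by simp⟩
  mul_mem' := fun {f g} hf hg x => (hg x).trans (hf (g x))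
  inv_mem' := fun {f} hf x => by
    have := hf (f⁻¹ x)
    rw [Diff.apply_inv_apply] at this
    exact this.symm

end OrbitEquivalence

end RigidAction

end

open RigidAction Manifold ContDiff

open Set Topology Manifold ContDiff

/-! Let `f` send every point into its `Γ`-orbit. The closed sets on which `f` coincides with a given
`γ` are countably many and cover `M`, so by Baire their interiors have dense union
(`dense_eventually_eq_of_mem_orbitInn`). Over that open set `f` has the germs of elements of `Γ`, so
it preserves `σ` on the frames there. Every frame `j(u)` is a limit of such frames, namely jets of
`u` at nearby points (`LocalParam.tendsto_frameAt`); continuity of `σ` and uniqueness of limits in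
`V` make `f` an automorphism (`GeometricStructure.mem_aut_of_dense`).

Now `f` and some `γ` are automorphisms with the same germ at a point, hence the same action on an
`r`-frame there, and freeness forces `f = γ` (`GeometricStructure.IsRigid.eq_of_eventually_eq`).

The consequences are formal: preserving orbits implies normalizing the inner group, which is now
`Γ`, and the automorphism of `Γ` is conjugation by `f`. -/

namespace RigidAction

/-! ### Jets of a parametrization at moving base points -/

section Translation

variable {n k r : ℕ}
variable {M : Type*} [TopologicalSpace M] [ChartedSpace (Euc n) M]

/-- The local parametrization `y ↦ e (y + t)` centred at a point `t` of the source of `e`. -/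
def LocalParam.centered (e : OpenPartialHomeomorph (Euc n) M)
    (he : ContMDiffOn (𝓡 n) (𝓡 n) k e e.source)
    (he' : ContMDiffOn (𝓡 n) (𝓡 n) k e.symm e.target) (t : Euc n) (ht : t ∈ e.source) :
    LocalParam n k M where
  toOpenPartialHomeomorph := (Homeomorph.addRight t).toOpenPartialHomeomorph.trans e
  zero_mem := ⟨mem_univ _, by simpa using ht⟩
  contMDiffOn_to := he.comp'
    (contDiff_id.add contDiff_const : ContDiff ℝ k fun y : Euc n => y + t).contMDiff.contMDiffOn
  contMDiffOn_inv := ((contDiff_id.add contDiff_const :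
    ContDiff ℝ k fun y : Euc n => y + -t).contMDiff.contMDiffOn (s := univ)).comp' he'

/-- The local parametrization `y ↦ u (y + t)`. -/
def LocalParam.translate (u : LocalParam n k M) (t : Euc n) (ht : t ∈ u.source) :
    LocalParam n k M :=
  LocalParam.centered u.toOpenPartialHomeomorph u.contMDiffOn_to u.contMDiffOn_inv t ht

theorem LocalParam.translate_apply (u : LocalParam n k M) {t : Euc n} (ht : t ∈ u.source)
    (y : Euc n) : (u.translate t ht).toFun y = u.toFun (y + t) := rfl

/-- Supplies a frame over each point, at which freeness can be tested: an inverse chart, recentred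
by a translation. -/
theorem LocalParam.exists_apply_zero [IsManifold (𝓡 n) k M] (x : M) :
    ∃ u : LocalParam n k M, u.toFun 0 = x := by
  refine ⟨LocalParam.centered (chartAt (Euc n) x).symm
    (contMDiffOn_chart_symm (I := 𝓡 n)) (contMDiffOn_chart (I := 𝓡 n))
    (chartAt (Euc n) x x) (mem_chart_target _ x), ?_⟩
  change (chartAt (Euc n) x).symm (0 + chartAt (Euc n) x x) = x
  rw [zero_add, (chartAt (Euc n) x).left_inv (mem_chart_source _ x)]

theorem contDiffAt_comp_of_mem_atlas [IsManifold (𝓡 n) k M] {φ : OpenPartialHomeomorph M (Euc n)}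
    (hφ : φ ∈ atlas (Euc n) M) {u : Euc n → M} {t : Euc n}
    (hu : ContMDiffAt (𝓡 n) (𝓡 n) k u t) (ht : u t ∈ φ.source) : ContDiffAt ℝ k (φ ∘ u) t :=
  (((contMDiffOn_of_mem_maximalAtlas (I := 𝓡 n)
    (IsManifold.subset_maximalAtlas hφ)).contMDiffAt (φ.open_source.mem_nhds ht)).comp t
      hu).contDiffAt

/-- Maps with the same `k`-jet have the same Taylor coefficients in every chart. -/
theorem SameJet.taylorCoeff_eq [IsManifold (𝓡 n) k M] {φ : OpenPartialHomeomorph M (Euc n)}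
    (hφ : φ ∈ atlas (Euc n) M) {u v : Euc n → M} (h : SameJet k u v)
    (hu : ContMDiffAt (𝓡 n) (𝓡 n) k u 0) (hv : ContMDiffAt (𝓡 n) (𝓡 n) k v 0)
    (h0 : u 0 ∈ φ.source) : taylorCoeff n k (φ ∘ u) = taylorCoeff n k (φ ∘ v) := by
  set ψ := extChartAt (𝓡 n) (u 0) with hψ
  -- `SameJet` compares derivatives only in the preferred chart `ψ` at `u 0`; the transition map `φ
  -- ∘ ψ.symm` and the chain rule carry the comparison to `φ`.
  have key : ∀ w : Euc n → M, ContMDiffAt (𝓡 n) (𝓡 n) k w 0 → w 0 = u 0 →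
      (φ ∘ w) =ᶠ[𝓝 0] ((φ ∘ ψ.symm) ∘ (ψ ∘ w)) := by
    intro w hw hw0
    have : ∀ᶠ y in 𝓝 (0 : Euc n), w y ∈ ψ.source :=
      hw.continuousAt.preimage_mem_nhds (by rw [hw0]; exact extChartAt_source_mem_nhds _)
    filter_upwards [this] with y hy
    simp [ψ.left_inv hy]
  have hG : ContDiffAt ℝ k (φ ∘ ψ.symm) ((ψ ∘ u) 0) := by
    refine contDiffAt_comp_of_mem_atlas hφ ?_ ?_
    · exact (contMDiffOn_extChartAt_symm (I := 𝓡 n) (u 0)).contMDiffAt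
        (extChartAt_target_mem_nhds _)
    · simpa [hψ] using h0
  funext i
  have hi : (i : ℕ) ≤ k := by omega
  change iteratedFDeriv ℝ i (φ ∘ u) 0 = iteratedFDeriv ℝ i (φ ∘ v) 0
  rw [((key u hu rfl).iteratedFDeriv ℝ i).eq_of_nhds,
    ((key v hv h.1.symm).iteratedFDeriv ℝ i).eq_of_nhds]
  refine iteratedFDeriv_comp_congr hG hG (contDiffAt_chart hu) ?_ ?_ h.2 (fun _ _ => rfl) i hi
  · have := contDiffAt_chart hv
    rwa [← h.1] at this
  · exact congrArg ψ h.1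

/-- The `k`-jet of `u` at `t`, as a frame; the value off the domain of `u` is arbitrary. -/
noncomputable def LocalParam.frameAt (u : LocalParam n k M) (t : Euc n) : Frame n k M :=
  open Classical in Quotient.mk _ (if ht : t ∈ u.source then u.translate t ht else u)

theorem LocalParam.frameAt_of_mem (u : LocalParam n k M) {t : Euc n} (ht : t ∈ u.source) :
    u.frameAt t = Quotient.mk _ (u.translate t ht) := by
  rw [LocalParam.frameAt, dif_pos ht]

/-- The frames `j(u (· + t))` tend to `j(u)` as `t` tends to the origin. -/
theorem LocalParam.tendsto_frameAt [IsManifold (𝓡 n) k M] (u : LocalParam n k M) :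
    Filter.Tendsto u.frameAt (𝓝 0) (𝓝 (Quotient.mk _ u : Frame n k M)) := by
  refine TopologicalSpace.tendsto_nhds_generateFrom_iff.2 ?_
  rintro _ ⟨φ, hφ, O, hO, rfl⟩ ⟨v, hvu, hv0, hvO⟩
  -- The subbasic set is witnessed by some representative `v` of the frame, so its condition is
  -- first transferred to `u`.
  have hvu' : SameJet k v.toFun u.toFun := Quotient.exact hvu
  rw [hvu'.taylorCoeff_eq hφ v.contMDiffAt u.contMDiffAt hv0] at hvO
  rw [hvu'.1] at hv0
  -- The Taylor coefficients of `y ↦ φ (u (y + t))` at the origin are the derivatives of `φ ∘ u` at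
  -- `t`, and those of order at most `k` are continuous in `t` at the origin.
  have hcont : ContinuousAt
      (fun t (i : Fin (k + 1)) => iteratedFDeriv ℝ (i : ℕ) (φ ∘ u.toFun) t) 0 :=
    continuousAt_pi.2 fun i =>
      (contDiffAt_comp_of_mem_atlas hφ u.contMDiffAt hv0).continuousAt_iteratedFDeriv
        (by exact_mod_cast Nat.lt_succ_iff.1 i.2)
  filter_upwards [u.open_source.mem_nhds u.zero_mem, hcont.preimage_mem_nhds (hO.mem_nhds hvO),
    u.contMDiffAt.continuousAt.preimage_mem_nhds (φ.open_source.mem_nhds hv0)] with t ht hO' hφ'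
  refine ⟨u.translate t ht, (u.frameAt_of_mem ht).symm, ?_, ?_⟩
  · rw [LocalParam.translate_apply, zero_add]
    exact hφ'
  · have : taylorCoeff n k (φ ∘ (u.translate t ht).toFun) =
        fun i : Fin (k + 1) => iteratedFDeriv ℝ (i : ℕ) (φ ∘ u.toFun) t := by
      funext i
      change iteratedFDeriv ℝ i (fun y => (φ ∘ u.toFun) (y + t)) 0 = _
      rw [iteratedFDeriv_comp_add_right, zero_add]
    rw [this]
    exact hO'

/-- Both sides are represented by `y ↦ f (u (y + t))`; this lets the limit along `frameAt` be taken
for `f ∘ u` and `u` simultaneously. -/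
theorem LocalParam.push_frameAt (hk : k ≤ r) (f : Diff n r M) (u : LocalParam n k M)
    {t : Euc n} (ht : t ∈ u.source) :
    (u.push hk f).frameAt t = prolong hk f (u.frameAt t) := by
  rw [u.frameAt_of_mem ht, (u.push hk f).frameAt_of_mem ⟨ht, mem_univ _⟩]
  exact Quotient.sound (SameJet.refl _)

/-- The prolongation of `f` at a frame over `x` depends only on the germ of `f` at `x`. -/
theorem prolong_congr (hk : k ≤ r) {f g : Diff n r M} (u : LocalParam n k M)
    (h : ∀ᶠ y in 𝓝 (u.toFun 0), f y = g y) :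
    prolong hk f (Quotient.mk _ u) = prolong hk g (Quotient.mk _ u) :=
  Quotient.sound (SameJet.of_eventuallyEq (u.contMDiffAt.continuousAt.eventually h))

end Translation

/-! ### Baire category, extension by continuity, and rigidity -/

section OrbitEquivalence

variable {n k r : ℕ} {Γ : Type*} [Group Γ]
variable {M : Type*} [TopologicalSpace M] [ChartedSpace (Euc n) M]

/-- A diffeomorphism that moves points along the orbits of a countable group agrees, near the points
of a dense set, with elements of the group. -/
theorem dense_eventually_eq_of_mem_orbitInn [T2Space M] [BaireSpace M] [Countable Γ]
    {ρ : Γ →* Diff n r M} {f : Diff n r M} (hf : f ∈ orbitInn ρ) :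
    Dense {x : M | ∃ γ : Γ, ∀ᶠ y in 𝓝 x, f y = ρ γ y} := by
  have hd : Dense (⋃ γ : Γ, interior {x : M | ρ γ x = f x}) :=
    dense_iUnion_interior_of_closed
      (fun γ => isClosed_eq (ρ γ).continuous f.continuous)
      (eq_univ_of_forall fun x => mem_iUnion.2 (hf x))
  refine hd.mono fun x hx => ?_
  obtain ⟨γ, hγ⟩ := mem_iUnion.1 hx
  exact ⟨γ, Filter.mem_of_superset (mem_interior_iff_mem_nhds.1 hγ) fun y hy => Eq.symm hy⟩

/-- A diffeomorphism that agrees with automorphisms of `σ` near the points of a dense set is an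
automorphism of `σ`. -/
theorem GeometricStructure.mem_aut_of_dense [IsManifold (𝓡 n) k M]
    {V : Type*} [TopologicalSpace V] [T2Space V] [MulAction (JetGroup n k) V]
    (σ : GeometricStructure n k M V) (hk : k ≤ r) {f : Diff n r M}
    (hf : Dense {x : M | ∃ g ∈ σ.aut r hk, ∀ᶠ y in 𝓝 x, f y = g y}) : f ∈ σ.aut r hk := by
  intro p
  induction p using Quotient.inductionOn with | _ u
  set S := {x : M | ∃ g ∈ σ.aut r hk, ∀ᶠ y in 𝓝 x, f y = g y}
  set D : Set (Euc n) := {t | t ∈ u.source ∧ u.toFun t ∈ S}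
  -- Since `u` is an open map on its source, the image of a neighbourhood of the origin is a
  -- nonempty open set and meets the dense set `S`.
  have hD : (0 : Euc n) ∈ closure D := by
    refine mem_closure_iff.2 fun W hW h0 => ?_
    obtain ⟨x, ⟨t, ⟨htu, htW⟩, rfl⟩, hx⟩ := hf.inter_open_nonempty _
      (u.toOpenPartialHomeomorph.isOpen_image_source_inter hW)
      ⟨u.toFun 0, 0, ⟨u.zero_mem, h0⟩, rfl⟩
    exact ⟨t, htW, htu, hx⟩
  have : (𝓝[D] (0 : Euc n)).NeBot := mem_closure_iff_nhdsWithin_neBot.1 hD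
  have hσ := σ.continuous_toFun.tendsto
  have h1 := ((hσ _).comp (u.push hk f).tendsto_frameAt).mono_left
    (nhdsWithin_le_nhds (s := D))
  have h2 := ((hσ _).comp u.tendsto_frameAt).mono_left (nhdsWithin_le_nhds (s := D))
  -- Along `D` both functions of `t` coincide, and their limits are the values of `σ` at the two
  -- frames to be compared.
  refine tendsto_nhds_unique_of_eventuallyEq h1 h2 ?_
  filter_upwards [self_mem_nhdsWithin] with t ht
  obtain ⟨htu, g, hg, hgf⟩ := ht
  change σ.toFun ((u.push hk f).frameAt t) = σ.toFun (u.frameAt t)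
  rw [u.push_frameAt hk f htu, u.frameAt_of_mem htu, prolong_congr hk (g := g)]
  · exact hg _
  · rwa [LocalParam.translate_apply, zero_add]

/-- Two automorphisms of a rigid structure that agree near a point are equal. -/
theorem GeometricStructure.IsRigid.eq_of_eventually_eq [IsManifold (𝓡 n) r M]
    {V : Type*} [TopologicalSpace V] [MulAction (JetGroup n k) V]
    {σ : GeometricStructure n k M V} {hk : k ≤ r} (hσ : σ.IsRigid r hk) {f g : Diff n r M}
    (hf : f ∈ σ.aut r hk) (hg : g ∈ σ.aut r hk) {x : M} (h : ∀ᶠ y in 𝓝 x, f y = g y) :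
    f = g := by
  obtain ⟨u, rfl⟩ := LocalParam.exists_apply_zero (n := n) (k := r) x
  let p : Frame n r M := Quotient.mk _ u
  have hp : f • p = g • p := prolong_congr le_rfl u h
  -- The automorphism `g⁻¹ * f` fixes the frame `p`.
  have h1 := hσ.free ((⟨g, hg⟩ : σ.aut r hk)⁻¹ * ⟨f, hf⟩) p (by
    change (g⁻¹ * f) • p = p
    rw [mul_smul, hp, inv_smul_smul])
  exact congrArg Subtype.val (inv_mul_eq_one.1 h1).symm

theorem range_le_orbitInn (ρ : Γ →* Diff n r M) : ρ.range ≤ orbitInn ρ := by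
  rintro _ ⟨γ, rfl⟩ x
  exact ⟨γ, rfl⟩

theorem range_eq_orbitInn_of_isRigid [T2Space M] [BaireSpace M] [IsManifold (𝓡 n) r M]
    {V : Type*} [TopologicalSpace V] [T2Space V] [MulAction (JetGroup n k) V]
    [Countable Γ] {ρ : Γ →* Diff n r M} {σ : GeometricStructure n k M V} {hk : k ≤ r}
    (hσ : σ.IsRigid r hk) (hρ : ∀ γ : Γ, ρ γ ∈ σ.aut r hk) : ρ.range = orbitInn ρ := by
  refine le_antisymm (range_le_orbitInn ρ) fun f hf => ?_
  have : IsManifold (𝓡 n) k M := IsManifold.of_le (n := (r : WithTop ℕ∞)) (by exact_mod_cast hk)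
  have hd := dense_eventually_eq_of_mem_orbitInn hf
  have hfσ : f ∈ σ.aut r hk :=
    σ.mem_aut_of_dense hk (hd.mono (by rintro x ⟨γ, hγ⟩; exact ⟨ρ γ, hρ γ, hγ⟩))
  -- Density yields a point only if `M` is nonempty; on empty `M` the only diffeomorphism is the
  -- identity.
  rcases isEmpty_or_nonempty M with hM | hM
  · rw [show f = 1 from Diffeomorph.ext fun x => hM.elim x]
    exact one_mem _
  · obtain ⟨x, γ, hγ⟩ := hd.nonempty
    exact ⟨γ, (hσ.eq_of_eventually_eq hfσ (hρ γ) hγ).symm⟩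

/-! ### Orbit-preserving maps and normalizers -/

theorem conj_mem_orbitInn {ρ : Γ →* Diff n r M} {f g : Diff n r M} (hf : f ∈ orbitAut ρ)
    (hg : g ∈ orbitInn ρ) : f * g * f⁻¹ ∈ orbitInn ρ := fun x => by
  have := (hf _ _).2 (hg (f⁻¹ x))
  rwa [Diff.apply_inv_apply] at this

theorem orbitAut_le_normalizer_orbitInn (ρ : Γ →* Diff n r M) :
    orbitAut ρ ≤ Subgroup.normalizer (orbitInn ρ : Set (Diff n r M)) := fun f hf =>
  Subgroup.mem_normalizer_iff.2 fun g => ⟨conj_mem_orbitInn hf, fun h => by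
    simpa [mul_assoc] using conj_mem_orbitInn (inv_mem hf) h⟩

theorem orbitRel_of_mem_normalizer {ρ : Γ →* Diff n r M} {f : Diff n r M}
    (hf : f ∈ Subgroup.normalizer (ρ.range : Set (Diff n r M))) {x y : M}
    (h : OrbitRel ρ x y) : OrbitRel ρ (f x) (f y) := by
  obtain ⟨γ, rfl⟩ := h
  -- `ρ δ` is the conjugate `f * ρ γ * f⁻¹`, which sends `f x` to `f (ρ γ x)`.
  obtain ⟨δ, hδ⟩ := (Subgroup.mem_normalizer_iff.1 hf (ρ γ)).1 ⟨γ, rfl⟩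
  exact ⟨δ, by rw [hδ]; simp⟩

theorem normalizer_range_le_orbitAut (ρ : Γ →* Diff n r M) :
    Subgroup.normalizer (ρ.range : Set (Diff n r M)) ≤ orbitAut ρ := fun f hf x y =>
  ⟨fun h => by simpa using orbitRel_of_mem_normalizer (inv_mem hf) h,
    orbitRel_of_mem_normalizer hf⟩

/-- An element of the normalizer of the acting group is equivariant up to an automorphism of the
group. -/
theorem exists_mulEquiv_of_mem_normalizer {H : Subgroup (Diff n r M)} {f : Diff n r M}
    (hf : f ∈ Subgroup.normalizer (H : Set (Diff n r M))) :
    ∃ α : H ≃* H, ∀ (g : H) (x : M), f ((g : Diff n r M) x) = (α g : Diff n r M) (f x) :=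
  ⟨H.normalizerMonoidHom ⟨f, hf⟩, fun g x => by
    change _ = (f * (g : Diff n r M) * f⁻¹) (f x)
    simp⟩

end OrbitEquivalence

end RigidAction

theorem mainTheorem6 {n k r m : ℕ} (hk : k ≤ r)
    {M : Type*} [TopologicalSpace M] [T2Space M] [CompactSpace M]
    [ChartedSpace (Euc n) M] [IsManifold (𝓡 n) ∞ M]
    {V : Type*} [TopologicalSpace V] [T2Space V] [ChartedSpace (Euc m) V]
    [MulAction (JetGroup n k) V] [ContinuousSMul (JetGroup n k) V]
    {Γ : Type*} [Group Γ] [Countable Γ] (ρ : Γ →* Diff n r M)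
    (σ : GeometricStructure n k M V) (hσ : σ.IsRigid r hk)
    (hρ : ∀ γ : Γ, ρ γ ∈ σ.aut r hk) :
    ρ.range = orbitInn ρ ∧
      (∀ f ∈ orbitAut ρ, ∃ α : ρ.range ≃* ρ.range,
        ∀ (g : ρ.range) (x : M), f ((g : Diff n r M) x) = (α g : Diff n r M) (f x)) ∧
      orbitAut ρ = Subgroup.normalizer (ρ.range : Set (Diff n r M)) := by

  have : IsManifold (𝓡 n) r M :=
    IsManifold.of_le (n := ∞) (by exact_mod_cast le_top)
  -- The Baire property of `M` comes from its being compact Hausdorff.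
  have hinn : ρ.range = orbitInn ρ := range_eq_orbitInn_of_isRigid hσ hρ
  have hnorm : orbitAut ρ = Subgroup.normalizer (ρ.range : Set (Diff n r M)) :=
    le_antisymm (hinn ▸ orbitAut_le_normalizer_orbitInn ρ) (normalizer_range_le_orbitAut ρ)
  exact ⟨hinn, fun f hf => exists_mulEquiv_of_mem_normalizer (hnorm ▸ hf), hnorm⟩
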